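/- Let $n\ge 2$, let $S^n=\{x\in\mathbb R^{n+1}:|x|=1\}$ carry the surface area measure $dx$, and let $\sigma_{n-1}=2\pi^{n/2}/\Gamma(n/2)$. For $\alpha>0$ define the one-sided spherical fractional integrals of a (real- or complex-valued) function $\varphi$ on $S^n$ by $$(S^\alpha_{+}\varphi)(x)=\frac{2}{\Gamma(\alpha)\,\sigma_{n-1}}\int_{\{y\in S^n:\,-1<y_{n+1}<x_{n+1}\}}\frac{(x_{n+1}-y_{n+1})^\alpha}{|x-y|^n}\,\varphi(y)\,dy,$$ $$(S^\alpha_{-}\varphi)(x)=\frac{2}{\Gamma(\alpha)\,\sigma_{n-1}}\int_{\{y\in S^n:\,x_{n+1}<y_{n+1}<1\}}\frac{(y_{n+1}-x_{n+1})^\alpha}{|x-y|^n}\,\varphi(y)\,dy.$$ Theorem. If $\alpha>0$ and $1<p<n/\alpha$, then the operators $S^\alpha_{+}$ and $S^\alpha_{-}$ are bounded from $L^p(S^n)$ to $L^{p_\alpha}(S^n)$, where $p_\alpha=\dfrac{np}{n-\alpha p}$. That is, there is a constant $C$, depending only on $n,\alpha,p$, such that for every $\varphi\in L^p(S^n)$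 the integrals defining $(S^\alpha_{\pm}\varphi)(x)$ converge absolutely for almost every $x\in S^n$, the functions $S^\alpha_{\pm}\varphi$ belong to $L^{p_\alpha}(S^n)$, and $$\|S^\alpha_{\pm}\varphi\|_{L^{p_\alpha}(S^n)}\le C\,\|\varphi\|_{L^p(S^n)}.$$ -/

import Mathlib

open MeasureTheory
open scoped ENNReal NNReal

noncomputable section

namespace SphFrac

/-- The unit sphere `S^n` in `ℝ^(n+1)`. -/
abbrev Sph (n : ℕ) : Type := Metric.sphere (0 : EuclideanSpace ℝ (Fin (n + 1))) 1

/-- The surface area measure on `S^n` (the measure of a set `s` is `n + 1` times the Lebesgue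
measure of the cone over `s` inside the unit ball). -/
def surfaceMeasure (n : ℕ) : Measure (Sph n) :=
  (volume : Measure (EuclideanSpace ℝ (Fin (n + 1)))).toSphere

/-- The last coordinate `x_{n+1}` of a point of `S^n`. -/
def lastCoord {n : ℕ} (x : Sph n) : ℝ :=
  (x : EuclideanSpace ℝ (Fin (n + 1))) (Fin.last n)

/-- The spherical segment `⟨a, b⟩_S`. -/
def segment (n : ℕ) (a b : ℝ) : Set (Sph n) := {y | a < lastCoord y ∧ lastCoord y < b}

/-- The surface area `σ_{n-1} = 2 π^{n/2} / Γ(n/2)` of the unit sphere of `ℝ^n`. -/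
def sigma (n : ℕ) : ℝ := 2 * Real.pi ^ ((n : ℝ) / 2) / Real.Gamma ((n : ℝ) / 2)

variable {𝕜 : Type*} [RCLike 𝕜] {n : ℕ}

/-- The integrand of the left-sided integral at the point `x`. -/
def leftIntegrand (α : ℝ) (φ : Sph n → 𝕜) (x y : Sph n) : 𝕜 :=
  ((lastCoord x - lastCoord y) ^ α / dist x y ^ n) • φ y

/-- The integrand of the right-sided integral at the point `x`. -/
def rightIntegrand (α : ℝ) (φ : Sph n → 𝕜) (x y : Sph n) : 𝕜 :=
  ((lastCoord y - lastCoord x) ^ α / dist x y ^ n) • φ y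

/-- The left-sided spherical fractional integral `S^α_{a+} φ`. -/
def leftInt (α a : ℝ) (φ : Sph n → 𝕜) (x : Sph n) : 𝕜 :=
  (2 / (Real.Gamma α * sigma n)) •
    ∫ y in segment n a (lastCoord x), leftIntegrand α φ x y ∂(surfaceMeasure n)

/-- The right-sided spherical fractional integral `S^α_{b-} φ`. -/
def rightInt (α b : ℝ) (φ : Sph n → 𝕜) (x : Sph n) : 𝕜 :=
  (2 / (Real.Gamma α * sigma n)) •
    ∫ y in segment n (lastCoord x) b, rightIntegrand α φ x y ∂(surfaceMeasure n)

/-- `S^α_+ = S^α_{-1+}`. -/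
def Splus (α : ℝ) (φ : Sph n → 𝕜) : Sph n → 𝕜 := leftInt α (-1) φ

/-- `S^α_- = S^α_{1-}`. -/
def Sminus (α : ℝ) (φ : Sph n → 𝕜) : Sph n → 𝕜 := rightInt α 1 φ

end SphFrac

end

namespace SphFrac

/-! Since `|x_{n+1} - y_{n+1}| ≤ |x - y|`, both one-sided kernels are dominated by the Riesz kernel
`|x - y|^(α - n)` (`rpow_div_dist_pow_le`). The theorem thus reduces to the Hardy-Littlewood-Sobolev
inequality for a finite measure with `μ (B(x, r)) ≤ A r^ν`, here with `ν = n`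
(`exists_surfaceMeasure_ball_le`).

That inequality is proved without maximal functions or an interpolation theorem. For `‖f‖_p ≤ 1` and
a level `t`, the potential is cut at a radius `ρ` and `f` at a height `a`. Hölder bounds the far
part by a multiple of `ρ^(α - ν/p)`; the near part of the bounded piece `f ≤ a` is at most a
multiple of `ρ^α a`. With `ρ` and `a` suitable powers of `t`, each is at most `t/3`, so the level
set is controlled by the near potential of `f 1_{f > a}`, which Chebyshev and Tonelli handle in `L¹`
(`exists_measure_lt_rieszPotential_le`). Because the cutoff `a` moves with `t`, integrating over `t`
gives the strong `L^p → L^q` bound at once (`exists_lintegral_rieszPotential_rpow_le`). -/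

/-! ### Integrals of powers and a layer-cake bound -/

theorem lintegral_Ioc_zero_rpow {s ρ : ℝ} (hs : -1 < s) (hρ : 0 < ρ) :
    ∫⁻ u in Set.Ioc 0 ρ, ENNReal.ofReal (u ^ s) = ENNReal.ofReal (ρ ^ (s + 1) / (s + 1)) := by
  rw [← ofReal_integral_eq_lintegral_ofReal, ← intervalIntegral.integral_of_le hρ.le,
    integral_rpow (Or.inl hs), Real.zero_rpow (by linarith), sub_zero]
  · exact (intervalIntegrable_iff_integrableOn_Ioc_of_le hρ.le).1
      (intervalIntegral.intervalIntegrable_rpow' hs)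
  · exact (ae_restrict_mem measurableSet_Ioc).mono fun u hu => Real.rpow_nonneg hu.1.le _

theorem lintegral_Ioi_rpow {s ρ : ℝ} (hs : s < -1) (hρ : 0 < ρ) :
    ∫⁻ u in Set.Ioi ρ, ENNReal.ofReal (u ^ s) = ENNReal.ofReal (-ρ ^ (s + 1) / (s + 1)) := by
  rw [← ofReal_integral_eq_lintegral_ofReal, integral_Ioi_rpow_of_lt hs hρ]
  · exact integrableOn_Ioi_rpow_of_lt hs hρ
  · exact (ae_restrict_mem measurableSet_Ioi).mono
      fun u hu => Real.rpow_nonneg (hρ.le.trans (le_of_lt hu)) _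

/-- Write `g^(-β)` as the integral of `β u^(-β-1)` over `u > g` and apply Tonelli. Only an
inequality holds in general: where `g = 0` the left side is `0 ^ (-β) = 0` by convention, while the
integral diverges. -/
theorem lintegral_rpow_neg_le {X : Type*} [MeasurableSpace X] (μ : Measure X) [SFinite μ]
    {g : X → ℝ} (hg : Measurable g) (hg0 : ∀ y, 0 ≤ g y) {β : ℝ} (hβ : 0 < β) :
    ∫⁻ y, ENNReal.ofReal (g y ^ (-β)) ∂μ ≤
      ∫⁻ u in Set.Ioi (0 : ℝ), ENNReal.ofReal (β * u ^ (-β - 1)) * μ {y | g y < u} := by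
  have h1 : ∀ y, ENNReal.ofReal (g y ^ (-β)) ≤ ∫⁻ u in Set.Ioi (0 : ℝ),
      {z : X × ℝ | g z.1 < z.2}.indicator
        (fun z => ENNReal.ofReal (β * z.2 ^ (-β - 1))) (y, u) := by
    intro y
    rcases (hg0 y).eq_or_lt with h | h
    · rw [← h, Real.zero_rpow (by linarith)]; simp
    · have e : ENNReal.ofReal (g y ^ (-β)) =
          ∫⁻ u in Set.Ioi (g y), ENNReal.ofReal (β * u ^ (-β - 1)) := by
        simp_rw [ENNReal.ofReal_mul hβ.le]
        rw [lintegral_const_mul _ (by fun_prop), lintegral_Ioi_rpow (by linarith) h,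
          ← ENNReal.ofReal_mul hβ.le]
        congr 1
        rw [show -β - 1 + 1 = -β by ring]
        field_simp
      rw [e, ← lintegral_indicator measurableSet_Ioi, ← lintegral_indicator measurableSet_Ioi]
      refine lintegral_mono fun u => ?_
      by_cases hu : g y < u
      · simp [Set.indicator, hu, h.trans hu]
      · simp [Set.indicator, hu]
  refine (lintegral_mono h1).trans ?_
  have hS : MeasurableSet {z : X × ℝ | g z.1 < z.2} :=
    measurableSet_lt (hg.comp measurable_fst) measurable_snd
  have hm : Measurable ({z : X × ℝ | g z.1 < z.2}.indicator
      (fun z => ENNReal.ofReal (β * z.2 ^ (-β - 1)))) :=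
    (by fun_prop : Measurable fun z : X × ℝ => ENNReal.ofReal (β * z.2 ^ (-β - 1))).indicator hS
  rw [lintegral_lintegral_swap (f := fun y u => {z : X × ℝ | g z.1 < z.2}.indicator
      (fun z => ENNReal.ofReal (β * z.2 ^ (-β - 1))) (y, u)) hm.aemeasurable]
  refine lintegral_mono fun u => ?_
  have : ∀ y, {z : X × ℝ | g z.1 < z.2}.indicator
      (fun z => ENNReal.ofReal (β * z.2 ^ (-β - 1))) (y, u) =
      {y | g y < u}.indicator (fun _ => ENNReal.ofReal (β * u ^ (-β - 1))) y := fun y => rfl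
  simp_rw [this]
  rw [lintegral_indicator_const (measurableSet_lt hg measurable_const)]

/-- Moves the dependence of the ball on its centre into an indicator on `X × X`, the form that
Tonelli and joint measurability need. -/
theorem setLIntegral_ball_eq {X : Type*} [PseudoMetricSpace X] [MeasurableSpace X]
    [BorelSpace X] {μ : Measure X} (F : X × X → ℝ≥0∞) (ρ : ℝ) (x : X) :
    ∫⁻ y in Metric.ball x ρ, F (x, y) ∂μ =
      ∫⁻ y, {z : X × X | dist z.1 z.2 < ρ}.indicator F (x, y) ∂μ := by
  rw [← lintegral_indicator Metric.isOpen_ball.measurableSet]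
  refine lintegral_congr fun y => ?_
  simp [Set.indicator, dist_comm]

/-! ### Powers of the distance on balls and their complements -/

section Potential

variable {X : Type*} [PseudoMetricSpace X] [MeasurableSpace X] [BorelSpace X]
  [SecondCountableTopology X] {μ : Measure X} [IsFiniteMeasure μ] {A ν : ℝ}

/-- In the layer-cake integral the sublevel sets have measure at most `A u^ν` for `u ≤ ρ` and at
most `A ρ^ν` beyond; these two ranges give the summands `β / (ν - β)` and `1`. -/
theorem lintegral_ball_dist_rpow_le (hA : 0 < A)
    (hμ : ∀ x r, 0 < r → μ (Metric.ball x r) ≤ ENNReal.ofReal (A * r ^ ν)) {β : ℝ} (hβ : 0 < β)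
    (hβν : β < ν) (x : X) {ρ : ℝ} (hρ : 0 < ρ) :
    ∫⁻ y in Metric.ball x ρ, ENNReal.ofReal (dist x y ^ (-β)) ∂μ ≤
      ENNReal.ofReal (A * (β / (ν - β) + 1) * ρ ^ (ν - β)) := by
  refine (lintegral_rpow_neg_le _ (by fun_prop) (fun y => dist_nonneg) hβ).trans ?_
  rw [← Set.Ioc_union_Ioi_eq_Ioi hρ.le,
    lintegral_union measurableSet_Ioi (Set.Ioc_disjoint_Ioi le_rfl)]
  have hset : ∀ u, {y | dist x y < u} = Metric.ball x u := fun u => by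
    ext y; simp [dist_comm]
  have h1 : ∫⁻ u in Set.Ioc 0 ρ, ENNReal.ofReal (β * u ^ (-β - 1)) *
      (μ.restrict (Metric.ball x ρ)) {y | dist x y < u} ≤
      ENNReal.ofReal (A * (β / (ν - β)) * ρ ^ (ν - β)) := by
    calc _ ≤ ∫⁻ u in Set.Ioc 0 ρ, ENNReal.ofReal (A * β) * ENNReal.ofReal (u ^ (ν - β - 1)) := by
          refine setLIntegral_mono' measurableSet_Ioc fun u hu => ?_
          rw [hset]
          refine (mul_le_mul_right ((Measure.restrict_apply_le _ _).trans (hμ x u hu.1)) _).trans ?_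
          have := Real.rpow_nonneg hu.1.le (-β - 1)
          rw [← ENNReal.ofReal_mul (by positivity), ← ENNReal.ofReal_mul (by positivity)]
          refine ENNReal.ofReal_le_ofReal (le_of_eq ?_)
          rw [show ν - β - 1 = (-β - 1) + ν by ring, Real.rpow_add hu.1]; ring
      _ = _ := by
          rw [lintegral_const_mul _ (by fun_prop), lintegral_Ioc_zero_rpow (by linarith) hρ,
            ← ENNReal.ofReal_mul (by positivity)]
          congr 1
          rw [show ν - β - 1 + 1 = ν - β by ring]; ring
  have h2 : ∫⁻ u in Set.Ioi ρ, ENNReal.ofReal (β * u ^ (-β - 1)) *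
      (μ.restrict (Metric.ball x ρ)) {y | dist x y < u} ≤
      ENNReal.ofReal (A * ρ ^ (ν - β)) := by
    calc _ ≤ ∫⁻ u in Set.Ioi ρ, ENNReal.ofReal (A * ρ ^ ν * β) *
            ENNReal.ofReal (u ^ (-β - 1)) := by
          refine setLIntegral_mono' measurableSet_Ioi fun u hu => ?_
          have hu0 : 0 < u := hρ.trans hu
          have hle : (μ.restrict (Metric.ball x ρ)) {y | dist x y < u} ≤
              ENNReal.ofReal (A * ρ ^ ν) :=
            (measure_mono (Set.subset_univ _)).trans
              (by rw [Measure.restrict_apply_univ]; exact hμ x ρ hρ)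
          refine (mul_le_mul_right hle _).trans ?_
          have := Real.rpow_nonneg hu0.le (-β - 1)
          rw [← ENNReal.ofReal_mul (by positivity), ← ENNReal.ofReal_mul (by positivity)]
          exact ENNReal.ofReal_le_ofReal (le_of_eq (by ring))
      _ = _ := by
          rw [lintegral_const_mul _ (by fun_prop), lintegral_Ioi_rpow (by linarith) hρ,
            ← ENNReal.ofReal_mul (by positivity)]
          congr 1
          rw [show -β - 1 + 1 = -β by ring, show ν - β = ν + -β by ring, Real.rpow_add hρ]
          field_simp
  refine (add_le_add h1 h2).trans ?_
  have : 0 < ν - β := by linarith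
  rw [← ENNReal.ofReal_add (by positivity) (by positivity)]
  exact ENNReal.ofReal_le_ofReal (le_of_eq (by ring))

theorem lintegral_compl_ball_dist_rpow_le (hA : 0 < A)
    (hμ : ∀ x r, 0 < r → μ (Metric.ball x r) ≤ ENNReal.ofReal (A * r ^ ν)) {β : ℝ} (hβ : 0 < β)
    (hβν : ν < β) (x : X) {ρ : ℝ} (hρ : 0 < ρ) :
    ∫⁻ y in (Metric.ball x ρ)ᶜ, ENNReal.ofReal (dist x y ^ (-β)) ∂μ ≤
      ENNReal.ofReal (A * (β / (β - ν)) * ρ ^ (ν - β)) := by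
  refine (lintegral_rpow_neg_le _ (by fun_prop) (fun y => dist_nonneg) hβ).trans ?_
  rw [← Set.Ioc_union_Ioi_eq_Ioi hρ.le,
    lintegral_union measurableSet_Ioi (Set.Ioc_disjoint_Ioi le_rfl)]
  have hset : ∀ u, {y | dist x y < u} = Metric.ball x u := fun u => by
    ext y; simp [dist_comm]
  have h1 : ∫⁻ u in Set.Ioc 0 ρ, ENNReal.ofReal (β * u ^ (-β - 1)) *
      (μ.restrict (Metric.ball x ρ)ᶜ) {y | dist x y < u} = 0 := by
    rw [setLIntegral_congr_fun (g := fun _ => 0) measurableSet_Ioc, lintegral_zero]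
    intro u hu
    have : Metric.ball x u ∩ (Metric.ball x ρ)ᶜ = ∅ := by
      rw [← Set.sdiff_eq, Set.sdiff_eq_empty]; exact Metric.ball_subset_ball hu.2
    simp only [hset]
    rw [Measure.restrict_apply Metric.isOpen_ball.measurableSet, this]
    simp
  rw [h1, zero_add]
  calc _ ≤ ∫⁻ u in Set.Ioi ρ, ENNReal.ofReal (A * β) * ENNReal.ofReal (u ^ (ν - β - 1)) := by
        refine setLIntegral_mono' measurableSet_Ioi fun u hu => ?_
        have hu0 : 0 < u := hρ.trans hu
        rw [hset]
        refine (mul_le_mul_right ((Measure.restrict_apply_le _ _).trans (hμ x u hu0)) _).trans ?_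
        have := Real.rpow_nonneg hu0.le (-β - 1)
        rw [← ENNReal.ofReal_mul (by positivity), ← ENNReal.ofReal_mul (by positivity)]
        refine ENNReal.ofReal_le_ofReal (le_of_eq ?_)
        rw [show ν - β - 1 = (-β - 1) + ν by ring, Real.rpow_add hu0]; ring
    _ = _ := by
        rw [lintegral_const_mul _ (by fun_prop), lintegral_Ioi_rpow (by linarith) hρ,
          ← ENNReal.ofReal_mul (by positivity)]
        congr 1
        rw [show ν - β - 1 + 1 = -(β - ν) by ring, show ν - β = -(β - ν) by ring, neg_div_neg_eq]
        ring

end Potential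

/-! ### The Hardy-Littlewood-Sobolev inequality -/

/-- The Riesz potential of `f` with kernel `dist x y ^ γ`. -/
noncomputable def rieszPotential {X : Type*} [PseudoMetricSpace X] [MeasurableSpace X]
    (μ : Measure X) (γ : ℝ) (f : X → ℝ≥0∞) (x : X) : ℝ≥0∞ :=
  ∫⁻ y, ENNReal.ofReal (dist x y ^ γ) * f y ∂μ

section Potential

variable {X : Type*} [PseudoMetricSpace X] [MeasurableSpace X] [BorelSpace X]
  [SecondCountableTopology X] {μ : Measure X} [IsFiniteMeasure μ] {A ν : ℝ}

theorem measurable_rieszPotential (γ : ℝ) {f : X → ℝ≥0∞} (hf : Measurable f) :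
    Measurable (rieszPotential μ γ f) := by
  unfold rieszPotential
  exact Measurable.lintegral_prod_right'
    (f := fun z : X × X => ENNReal.ofReal (dist z.1 z.2 ^ γ) * f z.2) (by fun_prop)

/-- Hölder with the conjugate exponent `r` of `p`: the kernel lies in `L^r` off the ball exactly
when `(ν - α) r > ν`, which is the condition `α p < ν`. -/
theorem exists_lintegral_compl_ball_mul_le (hA : 0 < A)
    (hμ : ∀ x r, 0 < r → μ (Metric.ball x r) ≤ ENNReal.ofReal (A * r ^ ν)) {α p : ℝ}
    (hα : 0 < α) (hp : 1 < p) (hαp : α * p < ν) :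
    ∃ C : ℝ, 0 < C ∧ ∀ f : X → ℝ≥0∞, Measurable f → ∫⁻ y, f y ^ p ∂μ ≤ 1 → ∀ x ρ, 0 < ρ →
      ∫⁻ y in (Metric.ball x ρ)ᶜ, ENNReal.ofReal (dist x y ^ (α - ν)) * f y ∂μ ≤
        ENNReal.ofReal (C * ρ ^ (α - ν / p)) := by
  have hp0 : 0 < p := by linarith
  have hpq := Real.HolderConjugate.conjExponent hp
  set r := Real.conjExponent p with hr
  have hr0 : 0 < r := hpq.symm.pos
  have hre : r * (p - 1) = p := by rw [hr, Real.conjExponent]; field_simp [sub_ne_zero.2 hp.ne']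
  have hαν : α < ν := by nlinarith
  have hβν : ν < (ν - α) * r := by
    have : ν * (p - 1) < ((ν - α) * r) * (p - 1) := by rw [mul_assoc, hre]; nlinarith
    exact lt_of_mul_lt_mul_right this (by linarith)
  have hβ : 0 < (ν - α) * r := by linarith
  have hβ' : 0 < (ν - α) * r - ν := by linarith
  have hr1 : 1 / r = 1 - 1 / p := by have := hpq.inv_add_inv_eq_one; simp only [one_div]; linarith
  refine ⟨(A * ((ν - α) * r / ((ν - α) * r - ν))) ^ (1 / r), by positivity, ?_⟩
  intro f hf hf1 x ρ hρ
  refine (ENNReal.lintegral_mul_le_Lp_mul_Lq _ hpq.symm (by fun_prop) hf.aemeasurable).trans ?_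
  have h1 : (∫⁻ y in (Metric.ball x ρ)ᶜ, f y ^ p ∂μ) ^ (1 / p) ≤ 1 :=
    ENNReal.rpow_le_one ((setLIntegral_le_lintegral _ _).trans hf1) (by positivity)
  refine (mul_le_mul_right h1 _).trans ?_
  rw [mul_one]
  have h2 : ∫⁻ y in (Metric.ball x ρ)ᶜ, ENNReal.ofReal (dist x y ^ (α - ν)) ^ r ∂μ ≤
      ENNReal.ofReal (A * ((ν - α) * r / ((ν - α) * r - ν)) * ρ ^ (ν - (ν - α) * r)) := by
    refine le_trans (le_of_eq ?_) (lintegral_compl_ball_dist_rpow_le hA hμ hβ hβν x hρ)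
    refine lintegral_congr fun y => ?_
    rw [ENNReal.ofReal_rpow_of_nonneg (by positivity) hr0.le, ← Real.rpow_mul dist_nonneg]
    congr 2; ring
  refine (ENNReal.rpow_le_rpow h2 (by positivity)).trans (le_of_eq ?_)
  rw [ENNReal.ofReal_rpow_of_nonneg (by positivity) (by positivity),
    Real.mul_rpow (by positivity) (by positivity), ← Real.rpow_mul hρ.le]
  congr 3
  rw [sub_mul, mul_assoc, mul_one_div_cancel hr0.ne', hr1]; ring

/-- The truncated kernel is symmetric, so Tonelli reduces the `L¹` bound to its integral over a ball
about `y`. -/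
theorem lintegral_ball_rieszPotential_le (hA : 0 < A)
    (hμ : ∀ x r, 0 < r → μ (Metric.ball x r) ≤ ENNReal.ofReal (A * r ^ ν)) {α : ℝ}
    (hα : 0 < α) (hαν : α < ν) {h : X → ℝ≥0∞} (hh : Measurable h) {ρ : ℝ} (hρ : 0 < ρ) :
    ∫⁻ x, ∫⁻ y in Metric.ball x ρ, ENNReal.ofReal (dist x y ^ (α - ν)) * h y ∂μ ∂μ ≤
      ENNReal.ofReal (A * ((ν - α) / α + 1) * ρ ^ α) * ∫⁻ y, h y ∂μ := by
  have hS : MeasurableSet {z : X × X | dist z.1 z.2 < ρ} :=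
    measurableSet_lt (by fun_prop) measurable_const
  have hm : Measurable ({z : X × X | dist z.1 z.2 < ρ}.indicator
      (fun z => ENNReal.ofReal (dist z.1 z.2 ^ (α - ν)) * h z.2)) :=
    Measurable.indicator (by fun_prop) hS
  simp_rw [setLIntegral_ball_eq fun z : X × X => ENNReal.ofReal (dist z.1 z.2 ^ (α - ν)) * h z.2]
  rw [lintegral_lintegral_swap (f := fun x y => {z : X × X | dist z.1 z.2 < ρ}.indicator
      (fun z => ENNReal.ofReal (dist z.1 z.2 ^ (α - ν)) * h z.2) (x, y)) hm.aemeasurable,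
    ← lintegral_const_mul _ hh]
  refine lintegral_mono fun y => ?_
  have e2 : ∀ x, {z : X × X | dist z.1 z.2 < ρ}.indicator
      (fun z => ENNReal.ofReal (dist z.1 z.2 ^ (α - ν)) * h z.2) (x, y) =
      (Metric.ball y ρ).indicator (fun x => ENNReal.ofReal (dist y x ^ (α - ν))) x * h y := by
    intro x
    by_cases hx : dist x y < ρ <;> simp [Set.indicator, hx, dist_comm y x]
  simp only [e2]
  rw [lintegral_mul_const _ (Measurable.indicator (by fun_prop) Metric.isOpen_ball.measurableSet),
    lintegral_indicator Metric.isOpen_ball.measurableSet]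
  refine mul_le_mul_left ?_ _
  have := lintegral_ball_dist_rpow_le hA hμ (β := ν - α) (by linarith) (by linarith) y hρ
  simpa using this

/-- If the potential exceeds `t` while the far part and the near part of `min f a` are each at most
`t/3`, the near potential of `f 1_{f > a}` must be at least `t/3`; Chebyshev then applies. -/
theorem measure_lt_rieszPotential_le (hA : 0 < A)
    (hμ : ∀ x r, 0 < r → μ (Metric.ball x r) ≤ ENNReal.ofReal (A * r ^ ν)) {α : ℝ}
    (hα : 0 < α) (hαν : α < ν) {f : X → ℝ≥0∞} (hf : Measurable f) {t ρ a : ℝ} (ht : 0 < t)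
    (hρ : 0 < ρ)
    (hfar : ∀ x, ∫⁻ y in (Metric.ball x ρ)ᶜ, ENNReal.ofReal (dist x y ^ (α - ν)) * f y ∂μ ≤
      ENNReal.ofReal (t / 3))
    (ha : A * ((ν - α) / α + 1) * ρ ^ α * a ≤ t / 3) :
    μ {x | ENNReal.ofReal t < rieszPotential μ (α - ν) f x} ≤
      ENNReal.ofReal (A * ((ν - α) / α + 1) * ρ ^ α / (t / 3)) *
        ∫⁻ y in {y | ENNReal.ofReal a < f y}, f y ∂μ := by
  have hE : MeasurableSet {y | ENNReal.ofReal a < f y} := measurableSet_lt measurable_const hf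
  have ht3 : 0 < t / 3 := by positivity
  have hsub : {x | ENNReal.ofReal t < rieszPotential μ (α - ν) f x} ⊆
      {x | ENNReal.ofReal (t / 3) ≤ ∫⁻ y in Metric.ball x ρ,
        ENNReal.ofReal (dist x y ^ (α - ν)) *
          {y | ENNReal.ofReal a < f y}.indicator f y ∂μ} := by
    intro x hx
    by_contra hlt
    simp only [Set.mem_ofPred_eq, not_le] at hx hlt
    refine hx.not_ge ?_
    rw [rieszPotential, ← lintegral_add_compl _ (Metric.isOpen_ball (x := x) (ε := ρ)).measurableSet]
    have hnear : ∫⁻ y in Metric.ball x ρ, ENNReal.ofReal (dist x y ^ (α - ν)) * f y ∂μ ≤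
        ENNReal.ofReal (t / 3) + ENNReal.ofReal (t / 3) := by
      calc _ ≤ ∫⁻ y in Metric.ball x ρ, (ENNReal.ofReal (dist x y ^ (α - ν)) *
            {y | ENNReal.ofReal a < f y}.indicator f y +
              ENNReal.ofReal (dist x y ^ (α - ν)) * ENNReal.ofReal a) ∂μ := by
            refine lintegral_mono fun y => ?_
            rw [← mul_add]
            refine mul_le_mul_right ?_ _
            by_cases hy : ENNReal.ofReal a < f y
            · simp [Set.indicator, hy]
            · simp only [Set.indicator, Set.mem_ofPred_eq, hy, if_false, zero_add]
              exact not_lt.1 hy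
        _ = (∫⁻ y in Metric.ball x ρ, ENNReal.ofReal (dist x y ^ (α - ν)) *
            {y | ENNReal.ofReal a < f y}.indicator f y ∂μ) +
            (∫⁻ y in Metric.ball x ρ, ENNReal.ofReal (dist x y ^ (α - ν)) ∂μ) *
              ENNReal.ofReal a := by
            rw [lintegral_add_right _ (by fun_prop), lintegral_mul_const _ (by fun_prop)]
        _ ≤ _ := by
            refine add_le_add hlt.le ?_
            have := lintegral_ball_dist_rpow_le hA hμ (β := ν - α) (by linarith) (by linarith) x hρ
            rw [neg_sub, sub_sub_cancel] at this
            refine (mul_le_mul_left this _).trans ?_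
            have : 0 < ν - α := by linarith
            rw [← ENNReal.ofReal_mul (by positivity)]
            exact ENNReal.ofReal_le_ofReal ha
    refine (add_le_add hnear (hfar x)).trans (le_of_eq ?_)
    rw [← ENNReal.ofReal_add ht3.le ht3.le, ← ENNReal.ofReal_add (by positivity) ht3.le]
    congr 1; ring
  refine (measure_mono hsub).trans ?_
  have hm : Measurable fun x => ∫⁻ y in Metric.ball x ρ,
      ENNReal.ofReal (dist x y ^ (α - ν)) * {y | ENNReal.ofReal a < f y}.indicator f y ∂μ := by
    have hS : MeasurableSet {z : X × X | dist z.1 z.2 < ρ} :=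
      measurableSet_lt (by fun_prop) measurable_const
    simp_rw [setLIntegral_ball_eq fun z : X × X => ENNReal.ofReal (dist z.1 z.2 ^ (α - ν)) *
      {y | ENNReal.ofReal a < f y}.indicator f z.2]
    exact Measurable.lintegral_prod_right' (((by fun_prop :
      Measurable fun z : X × X => ENNReal.ofReal (dist z.1 z.2 ^ (α - ν))).mul
        ((hf.indicator hE).comp measurable_snd)).indicator hS)
  have hne : ENNReal.ofReal (t / 3) ≠ 0 := by simpa using ht3
  refine (meas_ge_le_lintegral_div hm.aemeasurable hne ENNReal.ofReal_ne_top).trans ?_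
  rw [ENNReal.ofReal_div_of_pos ht3, ← ENNReal.mul_div_right_comm]
  refine ENNReal.div_le_div_right ?_ _
  refine (lintegral_ball_rieszPotential_le hA hμ hα hαν (hf.indicator hE) hρ).trans (le_of_eq ?_)
  rw [lintegral_indicator hE]


theorem exists_measure_lt_rieszPotential_le (hA : 0 < A)
    (hμ : ∀ x r, 0 < r → μ (Metric.ball x r) ≤ ENNReal.ofReal (A * r ^ ν)) {α p q : ℝ}
    (hα : 0 < α) (hp : 1 < p) (hαp : α * p < ν) (hq : 0 < q) (hpq : 1 / q = 1 / p - α / ν) :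
    ∃ c D : ℝ, 0 < c ∧ 0 < D ∧ ∀ f : X → ℝ≥0∞, Measurable f → ∫⁻ y, f y ^ p ∂μ ≤ 1 →
      ∀ t, 0 < t → μ {x | ENNReal.ofReal t < rieszPotential μ (α - ν) f x} ≤
        ENNReal.ofReal (D * t ^ (-(α * q / ν) - 1)) *
          ∫⁻ y in {y | ENNReal.ofReal (c * t ^ (q / p)) < f y}, f y ∂μ := by
  have hp0 : 0 < p := by linarith
  have hαν : α < ν := by nlinarith
  have hν : 0 < ν := by linarith
  obtain ⟨B, hB, hfar⟩ := exists_lintegral_compl_ball_mul_le hA hμ hα hp hαp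
  have hαν' : 0 < ν - α := by linarith
  set C := A * ((ν - α) / α + 1) with hC
  have hC0 : 0 < C := by positivity
  refine ⟨(3 * B) ^ (-(q / p)) * (B / C), (3 * B) ^ (α * q / ν) * (3 * C), by positivity,
    by positivity, ?_⟩
  intro f hf hf1 t ht
  -- Solves `B ρ^(α - ν/p) = t/3`, since `α - ν/p = -ν/q`. The height `a` below then solves `C ρ^α a
  -- = t/3`, which makes it a multiple of `t^(q/p)`.
  set ρ := (t / (3 * B)) ^ (-(q / ν)) with hρdef
  have hτ : 0 < t / (3 * B) := by positivity
  have hρ : 0 < ρ := by positivity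
  have hρα : ρ ^ α = (3 * B) ^ (α * q / ν) * t ^ (-(α * q / ν)) := by
    rw [hρdef, ← Real.rpow_mul hτ.le, Real.div_rpow ht.le (by positivity),
      show -(q / ν) * α = -(α * q / ν) by ring, Real.rpow_neg (by positivity : 0 ≤ 3 * B)]
    field_simp
  have e1 : α - ν / p = -(ν / q) := by
    have : ν * (1 / q) = ν * (1 / p - α / ν) := by rw [hpq]
    rw [mul_sub, mul_div_cancel₀ _ hν.ne'] at this
    linarith [mul_one_div ν q, mul_one_div ν p]
  have e2 : q / p = α * q / ν + 1 := by
    have : q * (1 / q) = q * (1 / p - α / ν) := by rw [hpq]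
    rw [mul_one_div_cancel hq.ne'] at this
    have h3 : q * (1 / p - α / ν) = q / p - α * q / ν := by ring
    linarith
  have key := measure_lt_rieszPotential_le hA hμ hα hαν hf ht hρ
    (a := (3 * B) ^ (-(q / p)) * (B / C) * t ^ (q / p)) ?_ ?_
  · refine key.trans (le_of_eq ?_)
    congr 2
    rw [hρα, ← hC, Real.rpow_sub_one ht.ne']
    field_simp
  · intro x
    refine (hfar f hf hf1 x ρ hρ).trans (ENNReal.ofReal_le_ofReal (le_of_eq ?_))
    rw [e1, hρdef, ← Real.rpow_mul hτ.le, show -(q / ν) * -(ν / q) = 1 by field_simp,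
      Real.rpow_one]
    field_simp
  · refine le_of_eq ?_
    rw [← hC, hρα, e2, Real.rpow_neg ht.le, Real.rpow_neg (by positivity),
      Real.rpow_add_one (by positivity), Real.rpow_add_one ht.ne']
    have h1 : 0 < (3 * B) ^ (α * q / ν) := by positivity
    have h2 : 0 < t ^ (α * q / ν) := by positivity
    field_simp

/-- Needed because the layer-cake formula is applied to `toReal` of the potential, which sends `∞`
to `0`. -/
theorem rieszPotential_ae_lt_top (hA : 0 < A)
    (hμ : ∀ x r, 0 < r → μ (Metric.ball x r) ≤ ENNReal.ofReal (A * r ^ ν)) {α p : ℝ}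
    (hα : 0 < α) (hp : 1 < p) (hαp : α * p < ν) {f : X → ℝ≥0∞} (hf : Measurable f)
    (hf1 : ∫⁻ y, f y ^ p ∂μ ≤ 1) :
    ∀ᵐ x ∂μ, rieszPotential μ (α - ν) f x < ∞ := by
  have hαν : α < ν := by nlinarith
  obtain ⟨B, hB, hfar⟩ := exists_lintegral_compl_ball_mul_le hA hμ hα hp hαp
  have hfin : ∫⁻ y, f y ∂μ ≠ ∞ := by
    -- On a finite measure space `f ≤ 1 + f^p` puts `f` in `L¹`.
    have h : ∫⁻ y, f y ∂μ ≤ ∫⁻ y, (1 + f y ^ p) ∂μ := by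
      refine lintegral_mono fun y => ?_
      rcases le_total (f y) 1 with h | h
      · exact h.trans le_self_add
      · calc f y = f y ^ (1 : ℝ) := (ENNReal.rpow_one _).symm
          _ ≤ f y ^ p := ENNReal.rpow_le_rpow_of_exponent_le h hp.le
          _ ≤ _ := le_add_self
    rw [lintegral_add_left measurable_const] at h
    refine ne_top_of_le_ne_top ?_ h
    simp only [lintegral_const, one_mul]
    exact ENNReal.add_ne_top.2 ⟨measure_ne_top _ _, ne_top_of_le_ne_top ENNReal.one_ne_top hf1⟩
  have hS : MeasurableSet {z : X × X | dist z.1 z.2 < 1} :=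
    measurableSet_lt (by fun_prop) measurable_const
  have hm : Measurable fun x => ∫⁻ y in Metric.ball x 1,
      ENNReal.ofReal (dist x y ^ (α - ν)) * f y ∂μ := by
    simp_rw [setLIntegral_ball_eq fun z : X × X => ENNReal.ofReal (dist z.1 z.2 ^ (α - ν)) *
      f z.2]
    exact Measurable.lintegral_prod_right' (Measurable.indicator (by fun_prop) hS)
  have h1 := lintegral_ball_rieszPotential_le hA hμ hα hαν hf one_pos
  have h2 := ae_lt_top hm
    (ne_top_of_le_ne_top (ENNReal.mul_ne_top ENNReal.ofReal_ne_top hfin) h1)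
  filter_upwards [h2] with x hx
  rw [rieszPotential, ← lintegral_add_compl _ (Metric.isOpen_ball (x := x) (ε := 1)).measurableSet]
  exact ENNReal.add_lt_top.2 ⟨hx, (hfar f hf hf1 x 1 one_pos).trans_lt ENNReal.ofReal_lt_top⟩

/-- The indicator restricts `t` to values below `(v / c)^(1/κ)`, and integrating `t^s` up to there
yields the power `(s + 1) / κ` of `v / c`. -/
theorem lintegral_rpow_mul_indicator_le {s c κ e : ℝ} (hs : -1 < s) (hc : 0 < c) (hκ : 0 < κ)
    (he : 0 < e) (hse : (s + 1) / κ = e) (v : ℝ≥0∞) :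
    (∫⁻ t in Set.Ioi (0 : ℝ), {t | ENNReal.ofReal (c * t ^ κ) < v}.indicator
        (fun t => ENNReal.ofReal (t ^ s)) t) ≤
      ENNReal.ofReal (c ^ (-e) / (s + 1)) * v ^ e := by
  have hs1 : 0 < s + 1 := by linarith
  have hce : 0 < c ^ (-e) / (s + 1) := by positivity
  rcases eq_or_ne v ∞ with rfl | hv
  · rw [ENNReal.top_rpow_of_pos he, ENNReal.mul_top (by simpa using hce)]; exact le_top
  rcases eq_or_ne v 0 with rfl | hv0
  · simp
  lift v to ℝ≥0 using hv
  have hv0 : 0 < (v : ℝ) := by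
    have : v ≠ 0 := by simpa using hv0
    exact_mod_cast pos_iff_ne_zero.2 this
  have hT : 0 < (v / c : ℝ) ^ (1 / κ) := by positivity
  calc _ ≤ ∫⁻ t in Set.Ioi (0 : ℝ), (Set.Ioc 0 ((v / c : ℝ) ^ (1 / κ))).indicator
        (fun t => ENNReal.ofReal (t ^ s)) t := by
        refine setLIntegral_mono' measurableSet_Ioi fun t ht => ?_
        have ht : 0 < t := ht
        by_cases h : ENNReal.ofReal (c * t ^ κ) < v
        · have h1 : t ^ κ < v / c := by
            rw [← ENNReal.ofReal_coe_nnreal, ENNReal.ofReal_lt_ofReal_iff hv0] at h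
            rwa [lt_div_iff₀' hc]
          have h2 : t ≤ (v / c : ℝ) ^ (1 / κ) := by
            rw [one_div, Real.le_rpow_inv_iff_of_pos ht.le (by positivity) hκ]
            exact h1.le
          simp only [one_div] at h2
          simp [Set.indicator, h, ht, h2]
        · simp [Set.indicator, h]
    _ ≤ ∫⁻ t in Set.Ioc 0 ((v / c : ℝ) ^ (1 / κ)), ENNReal.ofReal (t ^ s) := by
        refine (setLIntegral_le_lintegral _ _).trans ?_
        rw [lintegral_indicator measurableSet_Ioc]
    _ = ENNReal.ofReal (((v / c : ℝ) ^ (1 / κ)) ^ (s + 1) / (s + 1)) :=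
        lintegral_Ioc_zero_rpow hs hT
    _ = _ := by
        rw [← Real.rpow_mul (by positivity), show 1 / κ * (s + 1) = e by rw [← hse]; ring,
          Real.div_rpow hv0.le hc.le, Real.rpow_neg hc.le, ← ENNReal.ofReal_coe_nnreal,
          ENNReal.ofReal_rpow_of_pos hv0, ← ENNReal.ofReal_mul (by positivity)]
        congr 1; field_simp

theorem exists_lintegral_rieszPotential_rpow_le (hA : 0 < A)
    (hμ : ∀ x r, 0 < r → μ (Metric.ball x r) ≤ ENNReal.ofReal (A * r ^ ν)) {α p q : ℝ}
    (hα : 0 < α) (hp : 1 < p) (hαp : α * p < ν) (hq : 0 < q) (hpq : 1 / q = 1 / p - α / ν) :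
    ∃ M : ℝ≥0, ∀ f : X → ℝ≥0∞, Measurable f → ∫⁻ y, f y ^ p ∂μ ≤ 1 →
      ∫⁻ x, rieszPotential μ (α - ν) f x ^ q ∂μ ≤ M := by
  obtain ⟨c, D, hc, hD, hweak⟩ := exists_measure_lt_rieszPotential_le hA hμ hα hp hαp hq hpq
  have hp0 : 0 < p := by linarith
  have hν : 0 < ν := by nlinarith
  -- The weight `t^(q-1)` of the layer-cake formula times the decay `t^(-αq/ν - 1)` of the level-set
  -- bound.
  set s := q - 2 - α * q / ν with hs
  have e2 : q / p = α * q / ν + 1 := by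
    have : q * (1 / q) = q * (1 / p - α / ν) := by rw [hpq]
    rw [mul_one_div_cancel hq.ne'] at this
    have h3 : q * (1 / p - α / ν) = q / p - α * q / ν := by ring
    linarith
  -- With this exponent the inner `t`-integral is a multiple of `f^(p-1)`, which together with the
  -- factor `f` makes `f^p`.
  have hs1 : (s + 1) / (q / p) = p - 1 := by
    rw [hs, show q - 2 - α * q / ν + 1 = q - q / p by linarith]; field_simp
  have hs0 : 0 < s + 1 := by
    have := (div_eq_iff (by positivity : q / p ≠ 0)).1 hs1
    rw [this]; exact mul_pos (by linarith) (by positivity)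
  refine ⟨Real.toNNReal (q * D * (c ^ (-(p - 1)) / (s + 1))), fun f hf hf1 => ?_⟩
  have hfin := rieszPotential_ae_lt_top hA hμ hα hp hαp hf hf1
  have hmT := measurable_rieszPotential (μ := μ) (α - ν) hf
  have hS : MeasurableSet {z : X × ℝ | ENNReal.ofReal (c * z.2 ^ (q / p)) < f z.1} :=
    measurableSet_lt (by fun_prop) (by fun_prop)
  calc ∫⁻ x, rieszPotential μ (α - ν) f x ^ q ∂μ
      = ∫⁻ x, ENNReal.ofReal ((rieszPotential μ (α - ν) f x).toReal ^ q) ∂μ := by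
        refine lintegral_congr_ae ?_
        filter_upwards [hfin] with x hx
        rw [← ENNReal.ofReal_rpow_of_nonneg ENNReal.toReal_nonneg hq.le,
          ENNReal.ofReal_toReal hx.ne]
    _ = ENNReal.ofReal q * ∫⁻ t in Set.Ioi 0,
          μ {x | t < (rieszPotential μ (α - ν) f x).toReal} * ENNReal.ofReal (t ^ (q - 1)) :=
        lintegral_rpow_eq_lintegral_meas_lt_mul _
          (Filter.Eventually.of_forall fun _ => ENNReal.toReal_nonneg)
          hmT.ennreal_toReal.aemeasurable hq
    _ ≤ ENNReal.ofReal q * ∫⁻ t in Set.Ioi (0 : ℝ), ENNReal.ofReal D *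
          ∫⁻ y, f y * {t | ENNReal.ofReal (c * t ^ (q / p)) < f y}.indicator
            (fun t => ENNReal.ofReal (t ^ s)) t ∂μ := by
        refine mul_le_mul_right (setLIntegral_mono' measurableSet_Ioi fun t ht => ?_) _
        have ht : 0 < t := ht
        have h1 : μ {x | t < (rieszPotential μ (α - ν) f x).toReal} ≤
            μ {x | ENNReal.ofReal t < rieszPotential μ (α - ν) f x} := by
          refine measure_mono fun x hx => ?_
          exact (ENNReal.ofReal_lt_iff_lt_toReal ht.le (fun h => by
            have hx : t < (rieszPotential μ (α - ν) f x).toReal := hx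
            rw [h, ENNReal.toReal_top] at hx; linarith)).2 hx
        refine (mul_le_mul_left (h1.trans (hweak f hf hf1 t ht)) _).trans (le_of_eq ?_)
        have h2 : ∀ y, f y * {t | ENNReal.ofReal (c * t ^ (q / p)) < f y}.indicator
            (fun t => ENNReal.ofReal (t ^ s)) t =
            ENNReal.ofReal (t ^ s) * {y | ENNReal.ofReal (c * t ^ (q / p)) < f y}.indicator f y := by
          intro y
          by_cases hy : ENNReal.ofReal (c * t ^ (q / p)) < f y <;>
            simp [Set.indicator, hy, mul_comm]
        have hE : MeasurableSet {y | ENNReal.ofReal (c * t ^ (q / p)) < f y} :=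
          measurableSet_lt measurable_const hf
        simp_rw [h2]
        rw [lintegral_const_mul _ (hf.indicator hE), lintegral_indicator hE,
          ENNReal.ofReal_mul hD.le]
        have h3 : ENNReal.ofReal (t ^ s) =
            ENNReal.ofReal (t ^ (-(α * q / ν) - 1)) * ENNReal.ofReal (t ^ (q - 1)) := by
          rw [← ENNReal.ofReal_mul (by positivity), ← Real.rpow_add ht]
          congr 2; rw [hs]; ring
        rw [h3]; ring
    _ = ENNReal.ofReal q * (ENNReal.ofReal D * ∫⁻ y, (∫⁻ t in Set.Ioi (0 : ℝ),
          f y * {t | ENNReal.ofReal (c * t ^ (q / p)) < f y}.indicator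
            (fun t => ENNReal.ofReal (t ^ s)) t) ∂μ) := by
        have hm : Measurable fun z : X × ℝ => f z.1 *
            {z : X × ℝ | ENNReal.ofReal (c * z.2 ^ (q / p)) < f z.1}.indicator
              (fun z => ENNReal.ofReal (z.2 ^ s)) z :=
          (hf.comp measurable_fst).mul (Measurable.indicator (by fun_prop) hS)
        rw [lintegral_const_mul' _ _ ENNReal.ofReal_ne_top, ← lintegral_lintegral_swap
          (f := fun y t => f y * {t | ENNReal.ofReal (c * t ^ (q / p)) < f y}.indicator
            (fun t => ENNReal.ofReal (t ^ s)) t) hm.aemeasurable]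
    _ ≤ ENNReal.ofReal q * (ENNReal.ofReal D *
          ∫⁻ y, ENNReal.ofReal (c ^ (-(p - 1)) / (s + 1)) * f y ^ p ∂μ) := by
        refine mul_le_mul_right (mul_le_mul_right (lintegral_mono fun y => ?_) _) _
        have hE : MeasurableSet {t | ENNReal.ofReal (c * t ^ (q / p)) < f y} :=
          measurableSet_lt (by fun_prop) measurable_const
        rw [lintegral_const_mul _ (Measurable.indicator (by fun_prop) hE)]
        refine (mul_le_mul_right (lintegral_rpow_mul_indicator_le (by linarith) hc
          (by positivity) (by linarith) hs1 _) _).trans (le_of_eq ?_)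
        rw [mul_left_comm]
        congr 1
        rcases eq_or_ne (f y) ∞ with h | h
        · rw [h, ENNReal.top_rpow_of_pos (by linarith), ENNReal.top_rpow_of_pos hp0]; simp
        · conv_lhs => rw [← ENNReal.rpow_one (f y), ← ENNReal.rpow_mul, one_mul]
          rw [← ENNReal.rpow_add_of_nonneg _ _ zero_le_one (by linarith)]
          congr 1; ring
    _ ≤ _ := by
        rw [lintegral_const_mul _ (by fun_prop)]
        calc _ ≤ ENNReal.ofReal q * (ENNReal.ofReal D *
              (ENNReal.ofReal (c ^ (-(p - 1)) / (s + 1)) * 1)) := by gcongr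
          _ = _ := by
            rw [mul_one, ← ENNReal.ofReal_mul hD.le, ← ENNReal.ofReal_mul hq.le, ← mul_assoc]; rfl

/-- The Hardy-Littlewood-Sobolev inequality on a finite metric measure space of upper
dimension `ν`. -/
theorem exists_lintegral_rieszPotential_le (hA : 0 < A)
    (hμ : ∀ x r, 0 < r → μ (Metric.ball x r) ≤ ENNReal.ofReal (A * r ^ ν)) {α p q : ℝ}
    (hα : 0 < α) (hp : 1 < p) (hαp : α * p < ν) (hq : 0 < q) (hpq : 1 / q = 1 / p - α / ν) :
    ∃ M : ℝ≥0, ∀ f : X → ℝ≥0∞, Measurable f → ∫⁻ y, f y ^ p ∂μ ≠ ∞ →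
      (∫⁻ x, rieszPotential μ (α - ν) f x ^ q ∂μ) ^ (1 / q) ≤
        M * (∫⁻ y, f y ^ p ∂μ) ^ (1 / p) := by
  obtain ⟨M, hM⟩ := exists_lintegral_rieszPotential_rpow_le hA hμ hα hp hαp hq hpq
  have hp0 : 0 < p := by linarith
  refine ⟨M ^ (1 / q), fun f hf hfin => ?_⟩
  set N := (∫⁻ y, f y ^ p ∂μ) ^ (1 / p) with hN
  have hNtop : N ≠ ∞ := ENNReal.rpow_ne_top_of_nonneg (by positivity) hfin
  have hNp : N ^ p = ∫⁻ y, f y ^ p ∂μ := by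
    rw [hN, ← ENNReal.rpow_mul, one_div_mul_cancel hp0.ne', ENNReal.rpow_one]
  -- The normalisation `N⁻¹ * f` requires `N ≠ 0`; if `N = 0`, both `f` a.e. and its potential
  -- vanish.
  rcases eq_or_ne N 0 with h0 | h0
  · have hf0 : f =ᵐ[μ] 0 := by
      rw [h0, ENNReal.zero_rpow_of_pos hp0, eq_comm, lintegral_eq_zero_iff (by fun_prop)] at hNp
      filter_upwards [hNp] with y hy
      exact (ENNReal.rpow_eq_zero_iff_of_pos hp0).1 hy
    have hT : ∀ x, rieszPotential μ (α - ν) f x = 0 := fun x => by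
      rw [rieszPotential, lintegral_congr_ae (g := fun _ => 0), lintegral_zero]
      filter_upwards [hf0] with y hy
      simp [hy]
    simp [hT, hq]
  have hscale : ∀ x, rieszPotential μ (α - ν) f x =
      N * rieszPotential μ (α - ν) (fun y => N⁻¹ * f y) x := fun x => by
    rw [rieszPotential, rieszPotential, ← lintegral_const_mul' _ _ hNtop]
    refine lintegral_congr fun y => ?_
    rw [mul_left_comm, ← mul_assoc N, ENNReal.mul_inv_cancel h0 hNtop, one_mul]
  have h1 := hM (fun y => N⁻¹ * f y) (by fun_prop) (by
    simp_rw [ENNReal.mul_rpow_of_nonneg _ _ hp0.le]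
    rw [lintegral_const_mul _ (by fun_prop), ← hNp, ENNReal.inv_rpow, ENNReal.inv_mul_cancel]
    · simp [h0, hp0.le, hp0]
    · exact ENNReal.rpow_ne_top_of_nonneg hp0.le hNtop)
  simp_rw [hscale, ENNReal.mul_rpow_of_nonneg _ _ hq.le]
  rw [lintegral_const_mul' _ _ (ENNReal.rpow_ne_top_of_nonneg hq.le hNtop),
    ENNReal.mul_rpow_of_nonneg _ _ (by positivity), ← ENNReal.rpow_mul,
    mul_one_div_cancel hq.ne', ENNReal.rpow_one, mul_comm]
  refine mul_le_mul_left ?_ _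
  rw [ENNReal.coe_rpow_of_nonneg _ (by positivity)]
  exact ENNReal.rpow_le_rpow h1 (by positivity)

end Potential

/-! ### The surface measure of spherical caps -/

open scoped Pointwise

instance (n : ℕ) : IsFiniteMeasure (surfaceMeasure n) := by
  unfold surfaceMeasure; infer_instance

/-- With `k = ⌊s / r⌋`, the point `s • y` differs from `(k r) • x` by less than `r` in direction (`s
‖y - x‖`) and less than `r` along the ray (`s - k r`). About `1 / r` balls of radius `2r` therefore
cover the cone over a cap. -/
theorem Ioo_smul_ball_subset {E : Type*} [NormedAddCommGroup E] [NormedSpace ℝ E]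
    (x : Metric.sphere (0 : E) 1) {r : ℝ} (hr : 0 < r) :
    Set.Ioo (0 : ℝ) 1 • ((↑) '' Metric.ball x r : Set E) ⊆
      ⋃ k ∈ Finset.range ⌈1 / r⌉₊, Metric.ball ((k * r) • (x : E)) (2 * r) := by
  rintro _ ⟨s, hs, _, ⟨y, hy, rfl⟩, rfl⟩
  have hsr : 0 ≤ s / r := div_nonneg hs.1.le hr.le
  refine Set.mem_biUnion (x := ⌊s / r⌋₊) ?_ ?_
  · rw [Finset.mem_coe, Finset.mem_range, Nat.floor_lt hsr]
    exact ((div_lt_div_iff_of_pos_right hr).2 hs.2).trans_le (Nat.le_ceil _)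
  · have h1 : (⌊s / r⌋₊ : ℝ) * r ≤ s := (le_div_iff₀ hr).1 (Nat.floor_le hsr)
    have h2 : s < (⌊s / r⌋₊ + 1 : ℝ) * r := (div_lt_iff₀ hr).1 (Nat.lt_floor_add_one _)
    have hy : ‖(y : E) - x‖ < r := by rw [← dist_eq_norm]; exact hy
    have hx : ‖(x : E)‖ = 1 := norm_eq_of_mem_sphere x
    rw [Metric.mem_ball, dist_eq_norm]
    calc ‖s • (y : E) - ((⌊s / r⌋₊ : ℝ) * r) • (x : E)‖
        = ‖s • ((y : E) - x) + (s - (⌊s / r⌋₊ : ℝ) * r) • (x : E)‖ := by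
          congr 1; module
      _ ≤ s * ‖(y : E) - x‖ + (s - (⌊s / r⌋₊ : ℝ) * r) := by
          refine (norm_add_le _ _).trans ?_
          rw [norm_smul, norm_smul, hx, mul_one, Real.norm_of_nonneg hs.1.le,
            Real.norm_of_nonneg (by linarith)]
      _ < 2 * r := by nlinarith [norm_nonneg ((y : E) - x), hs.1, hs.2]

theorem exists_surfaceMeasure_ball_le (n : ℕ) :
    ∃ A : ℝ, 0 < A ∧ ∀ (x : Sph n) (r : ℝ), 0 < r →
      surfaceMeasure n (Metric.ball x r) ≤ ENNReal.ofReal (A * r ^ (n : ℝ)) := by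
  set b := (volume (Metric.ball (0 : EuclideanSpace ℝ (Fin (n + 1))) 1)).toReal with hb
  have hb0 : 0 ≤ b := ENNReal.toReal_nonneg
  set m := (surfaceMeasure n Set.univ).toReal with hm
  have hm0 : 0 ≤ m := ENNReal.toReal_nonneg
  -- The first summand comes from the covering when `r ≤ 1`, the total mass `m` handles `r ≥ 1`, and
  -- `+ 1` ensures positivity.
  refine ⟨(n + 1) * 2 ^ (n + 2) * b + m + 1, by positivity, fun x r hr => ?_⟩
  rw [Real.rpow_natCast]
  rcases le_total 1 r with h1 | h1
  · refine (measure_mono (Set.subset_univ _)).trans ?_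
    rw [← ENNReal.ofReal_toReal (measure_ne_top (surfaceMeasure n) Set.univ), ← hm]
    refine ENNReal.ofReal_le_ofReal ?_
    have : 1 ≤ r ^ n := one_le_pow₀ h1
    have : 0 ≤ (n + 1) * 2 ^ (n + 2) * b := by positivity
    nlinarith
  · rw [surfaceMeasure, Measure.toSphere_apply' _ Metric.isOpen_ball.measurableSet]
    have hcover := (measure_mono (μ := volume) (Ioo_smul_ball_subset x hr)).trans
      (measure_biUnion_finset_le _ _)
    have hball : ∀ k : ℕ, volume (Metric.ball ((k * r) • (x : EuclideanSpace ℝ (Fin (n + 1))))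
        (2 * r)) = ENNReal.ofReal ((2 * r) ^ (n + 1) * b) := fun k => by
      rw [Measure.addHaar_ball_of_pos _ _ (by positivity), ENNReal.ofReal_mul (by positivity), hb,
        ENNReal.ofReal_toReal measure_ball_lt_top.ne]
      simp
    simp_rw [hball] at hcover
    rw [Finset.sum_const, Finset.card_range, nsmul_eq_mul] at hcover
    refine (mul_le_mul_right hcover _).trans ?_
    rw [finrank_euclideanSpace, Fintype.card_fin, ← ENNReal.ofReal_natCast,
      ← ENNReal.ofReal_natCast, ← ENNReal.ofReal_mul (by positivity),
      ← ENNReal.ofReal_mul (by positivity)]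
    refine ENNReal.ofReal_le_ofReal ?_
    have hceil : (⌈1 / r⌉₊ : ℝ) ≤ 2 / r := by
      have h2 := (Nat.ceil_lt_add_one (by positivity : 0 ≤ 1 / r)).le
      have : 1 ≤ 1 / r := (one_le_div hr).2 h1
      calc _ ≤ 1 / r + 1 := h2
        _ ≤ 1 / r + 1 / r := by linarith
        _ = _ := by ring
    push_cast
    calc ((n : ℝ) + 1) * (⌈1 / r⌉₊ * ((2 * r) ^ (n + 1) * b))
        ≤ (n + 1) * (2 / r * ((2 * r) ^ (n + 1) * b)) := by gcongr
      _ = (n + 1) * 2 ^ (n + 2) * b * r ^ n := by field_simp; ring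
      _ ≤ _ := by gcongr; linarith

/-! ### From the potential to dominated kernels -/

/-- An integral operator whose kernel is dominated by that of the Riesz potential is bounded
from `L^p` to `L^q`. -/
theorem exists_eLpNorm_integral_kernel_le {X : Type*} [PseudoMetricSpace X] [MeasurableSpace X]
    [BorelSpace X] [SecondCountableTopology X] {μ : Measure X} [IsFiniteMeasure μ] {A ν : ℝ}
    (hA : 0 < A) (hμ : ∀ x r, 0 < r → μ (Metric.ball x r) ≤ ENNReal.ofReal (A * r ^ ν))
    {α p q : ℝ} (hα : 0 < α) (hp : 1 < p) (hαp : α * p < ν) (hq : 0 < q)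
    (hpq : 1 / q = 1 / p - α / ν) (𝕜 : Type*) [RCLike 𝕜] :
    ∃ M : ℝ≥0, ∀ k : X → X → ℝ, Measurable (Function.uncurry k) →
      (∀ x y, |k x y| ≤ dist x y ^ (α - ν)) → ∀ φ : X → 𝕜, MemLp φ (ENNReal.ofReal p) μ →
        (∀ᵐ x ∂μ, Integrable (fun y => k x y • φ y) μ) ∧
        MemLp (fun x => ∫ y, k x y • φ y ∂μ) (ENNReal.ofReal q) μ ∧
        eLpNorm (fun x => ∫ y, k x y • φ y ∂μ) (ENNReal.ofReal q) μ ≤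
          M * eLpNorm φ (ENNReal.ofReal p) μ := by
  obtain ⟨M, hM⟩ := exists_lintegral_rieszPotential_le hA hμ hα hp hαp hq hpq
  have hp0 : 0 < p := by linarith
  refine ⟨M, fun k hk hkd φ hφ => ?_⟩
  -- The potential estimate asks for a genuinely measurable function; the integrals over `y` do not
  -- see the change of representative.
  set ψ := hφ.1.mk φ with hψ
  have hψm : StronglyMeasurable ψ := hφ.1.stronglyMeasurable_mk
  have hφψ : φ =ᵐ[μ] ψ := hφ.1.ae_eq_mk
  have hnorm : ∀ {r : ℝ}, 0 < r → ∀ g : X → 𝕜,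
      eLpNorm g (ENNReal.ofReal r) μ = (∫⁻ x, ‖g x‖ₑ ^ r ∂μ) ^ (1 / r) := fun hr g => by
    rw [eLpNorm_eq_lintegral_rpow_enorm_toReal (by simpa using hr) ENNReal.ofReal_ne_top,
      ENNReal.toReal_ofReal hr.le]
  have hφnorm : eLpNorm φ (ENNReal.ofReal p) μ = (∫⁻ y, ‖ψ y‖ₑ ^ p ∂μ) ^ (1 / p) := by
    rw [eLpNorm_congr_ae hφψ, hnorm hp0]
  have hfin : ∫⁻ y, ‖ψ y‖ₑ ^ p ∂μ ≠ ∞ := fun h => by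
    have := hφ.2
    rw [hφnorm, h, ENNReal.top_rpow_of_pos (by positivity)] at this
    exact this.ne rfl
  have hf : Measurable fun y => ‖ψ y‖ₑ := hψm.enorm
  have key := hM _ hf hfin
  rw [← hφnorm] at key
  set T := rieszPotential μ (α - ν) (fun y => ‖ψ y‖ₑ) with hT
  have hTm : Measurable T := measurable_rieszPotential _ hf
  have hbound : ∀ x, ∫⁻ y, ‖k x y • φ y‖ₑ ∂μ ≤ T x := fun x => by
    rw [hT, rieszPotential]
    refine lintegral_mono_ae ?_
    filter_upwards [hφψ] with y hy
    rw [hy, enorm_smul, ← ofReal_norm (k x y), Real.norm_eq_abs]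
    exact mul_le_mul_left (ENNReal.ofReal_le_ofReal (hkd x y)) _
  have hMfin : M * eLpNorm φ (ENNReal.ofReal p) μ < ∞ := ENNReal.mul_lt_top ENNReal.coe_lt_top hφ.2
  have hTfin : ∀ᵐ x ∂μ, T x < ∞ := by
    have h1 : ∫⁻ x, T x ^ q ∂μ ≠ ∞ := fun h => by
      rw [h, ENNReal.top_rpow_of_pos (by positivity)] at key
      exact (key.trans_lt hMfin).ne rfl
    filter_upwards [ae_lt_top (hTm.pow_const q) h1] with x hx
    by_contra h
    rw [not_lt_top_iff.1 h, ENNReal.top_rpow_of_pos hq] at hx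
    exact hx.ne rfl
  have hle : eLpNorm (fun x => ∫ y, k x y • φ y ∂μ) (ENNReal.ofReal q) μ ≤
      M * eLpNorm φ (ENNReal.ofReal p) μ := by
    refine le_trans ?_ key
    rw [hnorm hq]
    refine ENNReal.rpow_le_rpow (lintegral_mono fun x => ?_) (by positivity)
    exact ENNReal.rpow_le_rpow ((enorm_integral_le_lintegral_enorm _).trans (hbound x)) hq.le
  refine ⟨?_, ⟨?_, hle.trans_lt hMfin⟩, hle⟩
  · filter_upwards [hTfin] with x hx
    exact ⟨(hk.of_uncurry_left).aestronglyMeasurable.smul hφ.1, (hbound x).trans_lt hx⟩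
  · have e : (fun x => ∫ y, k x y • φ y ∂μ) = fun x => ∫ y, k x y • ψ y ∂μ := by
      funext x
      refine integral_congr_ae ?_
      filter_upwards [hφψ] with y hy
      rw [hy]
    rw [e]
    exact (StronglyMeasurable.integral_prod_right (f := fun x y => k x y • ψ y)
      (hk.stronglyMeasurable.smul (hψm.comp_measurable measurable_snd))).aestronglyMeasurable

/-! ### The one-sided kernels on the sphere -/

variable {n : ℕ}

theorem measurable_lastCoord : Measurable (lastCoord : Sph n → ℝ) := by
  unfold lastCoord; fun_prop

theorem abs_lastCoord_sub_le (x y : Sph n) : |lastCoord x - lastCoord y| ≤ dist x y := by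
  have := PiLp.norm_apply_le ((x : EuclideanSpace ℝ (Fin (n + 1))) -
    (y : EuclideanSpace ℝ (Fin (n + 1)))) (Fin.last n)
  rwa [← dist_eq_norm] at this

/-- Applied with `s` the height difference: on the segment it is positive, which keeps `y` off the
diagonal, and it is at most the chord length. -/
theorem rpow_div_dist_pow_le {α s : ℝ} (hα : 0 < α) {x y : Sph n} (hs : 0 < s)
    (hsd : s ≤ dist x y) : |s ^ α / dist x y ^ n| ≤ dist x y ^ (α - n) := by
  have hd : 0 < dist x y := hs.trans_le hsd
  rw [abs_of_nonneg (by positivity), Real.rpow_sub hd, Real.rpow_natCast]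
  gcongr

/-- The kernel of the left-sided integral, extended by zero. -/
noncomputable def leftKernel (α a : ℝ) (x y : Sph n) : ℝ :=
  (segment n a (lastCoord x)).indicator
    (fun y => (lastCoord x - lastCoord y) ^ α / dist x y ^ n) y

/-- The kernel of the right-sided integral, extended by zero. -/
noncomputable def rightKernel (α b : ℝ) (x y : Sph n) : ℝ :=
  (segment n (lastCoord x) b).indicator
    (fun y => (lastCoord y - lastCoord x) ^ α / dist x y ^ n) y

theorem measurableSet_segment (a b : ℝ) : MeasurableSet (segment n a b) :=
  (measurableSet_lt measurable_const measurable_lastCoord).inter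
    (measurableSet_lt measurable_lastCoord measurable_const)

theorem measurable_leftKernel (α a : ℝ) :
    Measurable (Function.uncurry (leftKernel α a : Sph n → Sph n → ℝ)) := by
  have h1 : Measurable fun z : Sph n × Sph n => lastCoord z.1 :=
    measurable_lastCoord.comp measurable_fst
  have h2 : Measurable fun z : Sph n × Sph n => lastCoord z.2 :=
    measurable_lastCoord.comp measurable_snd
  exact Measurable.indicator
    (f := fun z : Sph n × Sph n => (lastCoord z.1 - lastCoord z.2) ^ α / dist z.1 z.2 ^ n)
    (by fun_prop) ((measurableSet_lt measurable_const h2).inter (measurableSet_lt h2 h1))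

theorem measurable_rightKernel (α b : ℝ) :
    Measurable (Function.uncurry (rightKernel α b : Sph n → Sph n → ℝ)) := by
  have h1 : Measurable fun z : Sph n × Sph n => lastCoord z.1 :=
    measurable_lastCoord.comp measurable_fst
  have h2 : Measurable fun z : Sph n × Sph n => lastCoord z.2 :=
    measurable_lastCoord.comp measurable_snd
  exact Measurable.indicator
    (f := fun z : Sph n × Sph n => (lastCoord z.2 - lastCoord z.1) ^ α / dist z.1 z.2 ^ n)
    (by fun_prop) ((measurableSet_lt h1 h2).inter (measurableSet_lt h2 measurable_const))

theorem abs_leftKernel_le {α : ℝ} (hα : 0 < α) (a : ℝ) (x y : Sph n) :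
    |leftKernel α a x y| ≤ dist x y ^ (α - n) := by
  by_cases h : y ∈ segment n a (lastCoord x)
  · rw [leftKernel, Set.indicator_of_mem h]
    exact rpow_div_dist_pow_le hα (sub_pos.2 h.2)
      ((le_abs_self _).trans (abs_lastCoord_sub_le x y))
  · rw [leftKernel, Set.indicator_of_notMem h, abs_zero]
    positivity

theorem abs_rightKernel_le {α : ℝ} (hα : 0 < α) (b : ℝ) (x y : Sph n) :
    |rightKernel α b x y| ≤ dist x y ^ (α - n) := by
  by_cases h : y ∈ segment n (lastCoord x) b
  · rw [rightKernel, Set.indicator_of_mem h]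
    refine rpow_div_dist_pow_le hα (sub_pos.2 h.1) ((le_abs_self _).trans ?_)
    rw [abs_sub_comm]
    exact abs_lastCoord_sub_le x y
  · rw [rightKernel, Set.indicator_of_notMem h, abs_zero]
    positivity

variable {𝕜 : Type*} [RCLike 𝕜]

theorem leftKernel_smul (α a : ℝ) (φ : Sph n → 𝕜) (x : Sph n) :
    (fun y => leftKernel α a x y • φ y) =
      (segment n a (lastCoord x)).indicator (leftIntegrand α φ x) := by
  funext y
  by_cases h : y ∈ segment n a (lastCoord x) <;> simp [leftKernel, leftIntegrand, h]

theorem rightKernel_smul (α b : ℝ) (φ : Sph n → 𝕜) (x : Sph n) :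
    (fun y => rightKernel α b x y • φ y) =
      (segment n (lastCoord x) b).indicator (rightIntegrand α φ x) := by
  funext y
  by_cases h : y ∈ segment n (lastCoord x) b <;> simp [rightKernel, rightIntegrand, h]

theorem leftInt_eq (α a : ℝ) (φ : Sph n → 𝕜) :
    leftInt α a φ = (2 / (Real.Gamma α * sigma n)) •
      fun x => ∫ y, leftKernel α a x y • φ y ∂(surfaceMeasure n) := by
  funext x
  rw [Pi.smul_apply, leftKernel_smul, integral_indicator (measurableSet_segment _ _)]
  rfl

theorem rightInt_eq (α b : ℝ) (φ : Sph n → 𝕜) :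
    rightInt α b φ = (2 / (Real.Gamma α * sigma n)) •
      fun x => ∫ y, rightKernel α b x y • φ y ∂(surfaceMeasure n) := by
  funext x
  rw [Pi.smul_apply, rightKernel_smul, integral_indicator (measurableSet_segment _ _)]
  rfl

end SphFrac

theorem mainTheorem6 {𝕜 : Type*} [RCLike 𝕜] (n : ℕ) (hn : 2 ≤ n) (α p : ℝ) (hα : 0 < α)
    (hp : 1 < p) (hpn : p < (n : ℝ) / α) :
    ∃ C : ℝ≥0, ∀ φ : SphFrac.Sph n → 𝕜,
      MemLp φ (ENNReal.ofReal p) (SphFrac.surfaceMeasure n) →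
      ((∀ᵐ x ∂(SphFrac.surfaceMeasure n),
          IntegrableOn (SphFrac.leftIntegrand α φ x)
            (SphFrac.segment n (-1) (SphFrac.lastCoord x)) (SphFrac.surfaceMeasure n)) ∧
        MemLp (SphFrac.Splus α φ) (ENNReal.ofReal (n * p / (n - α * p)))
          (SphFrac.surfaceMeasure n) ∧
        eLpNorm (SphFrac.Splus α φ) (ENNReal.ofReal (n * p / (n - α * p)))
            (SphFrac.surfaceMeasure n) ≤
          C * eLpNorm φ (ENNReal.ofReal p) (SphFrac.surfaceMeasure n)) ∧
      ((∀ᵐ x ∂(SphFrac.surfaceMeasure n),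
          IntegrableOn (SphFrac.rightIntegrand α φ x)
            (SphFrac.segment n (SphFrac.lastCoord x) 1) (SphFrac.surfaceMeasure n)) ∧
        MemLp (SphFrac.Sminus α φ) (ENNReal.ofReal (n * p / (n - α * p)))
          (SphFrac.surfaceMeasure n) ∧
        eLpNorm (SphFrac.Sminus α φ) (ENNReal.ofReal (n * p / (n - α * p)))
            (SphFrac.surfaceMeasure n) ≤
          C * eLpNorm φ (ENNReal.ofReal p) (SphFrac.surfaceMeasure n)) := by
  have hαp : α * p < n := by rwa [lt_div_iff₀ hα, mul_comm] at hpn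
  have hn0 : (0 : ℝ) < n := by positivity
  have hnαp : 0 < n - α * p := by linarith
  have hp0 : 0 < p := by linarith
  have hq : 0 < n * p / (n - α * p) := by positivity
  have hpq : 1 / (n * p / (n - α * p)) = 1 / p - α / n := by field_simp
  obtain ⟨A, hA, hμ⟩ := SphFrac.exists_surfaceMeasure_ball_le n
  obtain ⟨M, hM⟩ :=
    SphFrac.exists_eLpNorm_integral_kernel_le hA hμ hα hp hαp hq hpq 𝕜
  -- One `M` serves both operators, as it depends only on the dominating Riesz kernel; the other
  -- factor is their common normalisation.
  refine ⟨‖2 / (Real.Gamma α * SphFrac.sigma n)‖₊ * M, fun φ hφ => ⟨?_, ?_⟩⟩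
  · obtain ⟨h1, h2, h3⟩ := hM _ (SphFrac.measurable_leftKernel α (-1))
      (SphFrac.abs_leftKernel_le hα (-1)) φ hφ
    rw [SphFrac.Splus, SphFrac.leftInt_eq]
    refine ⟨?_, h2.const_smul _, ?_⟩
    · filter_upwards [h1] with x hx
      rwa [SphFrac.leftKernel_smul,
        integrable_indicator_iff (SphFrac.measurableSet_segment _ _)] at hx
    · rw [eLpNorm_const_smul, ENNReal.coe_mul, mul_assoc]
      exact mul_le_mul_right h3 _
  · obtain ⟨h1, h2, h3⟩ := hM _ (SphFrac.measurable_rightKernel α 1)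
      (SphFrac.abs_rightKernel_le hα 1) φ hφ
    rw [SphFrac.Sminus, SphFrac.rightInt_eq]
    refine ⟨?_, h2.const_smul _, ?_⟩
    · filter_upwards [h1] with x hx
      rwa [SphFrac.rightKernel_smul,
        integrable_indicator_iff (SphFrac.measurableSet_segment _ _)] at hx
    · rw [eLpNorm_const_smul, ENNReal.coe_mul, mul_assoc]
      exact mul_le_mul_right h3 _
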